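/- Let $X$ be a complex Banach space and $T\in L(X)$ a bounded linear operator. Write $\mathcal N(T)$, $\mathcal R(T)$ for kernel and range, $\alpha(T)=\dim\mathcal N(T)$ and $\beta(T)=\operatorname{codim}\mathcal R(T)$ (each in $\mathbb N\cup\{\infty\}$), and let $T_{[n]}$ be the restriction of $T$ to $\mathcal R(T^n)$, as an operator on $\mathcal R(T^n)$. With $\inf\emptyset=\infty$ put $$a_e(T)=\inf\{n:\alpha(T_{[n]})<\infty\},\quad d_e(T)=\inf\{n:\beta(T_{[n]})<\infty\},\quad m_T=\inf\{n:\min(\alpha(T_{[n]}),\beta(T_{[n]}))<\infty\}.$$ $T$ is upper semi-B-Fredholm if $a_e(T)<\infty$ and $\mathcal R(T^{a_e(T)+1})$ is closed, lower semi-B-Fredholm if $d_e(T)<\infty$ and $\mathcal R(T^{d_e(T)})$ is closed, and B-Fredholm if it is both; the index of a B-Fredholm operator is $\operatorname{ind}(T)=\alpha(T_{[m_T]})-\beta(T_{[m_T]})$. An upper (lower) semi-B-Fredholm operator with $m_T=0$ is called upper (lower) semi-Fredholm; $T$ is semi-Fredholm if it is upper or lower semi-Fredholm, and then its index is $\alpha(T)-\beta(T)\in\mathbb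 Z\cup\{\pm\infty\}$. Write $(M,N)\in Red(T)$ if $M,N$ are closed $T$-invariant subspaces with $X=M\oplus N$, and let $T_M,T_N$ be the restrictions of $T$. $T$ is quasi upper (lower) semi-B-Fredholm if there is $(M,N)\in Red(T)$ with $T_M$ upper (lower) semi-Fredholm and $T_N$ nilpotent, and quasi B-Fredholm if it is both quasi upper and quasi lower semi-B-Fredholm (the two decompositions may differ). An operator is Drazin invertible if it is a direct sum (over some $(M,N)\in Red$) of an invertible and a nilpotent operator; it is meromorphic if $T-\lambda I$ is Drazin invertible for all $\lambda\in\mathbb C\setminus\{0\}$ (for example, if it is nilpotent). The index of a quasi B-Fredholm operator $T$ is the index of $T_M$ for any $(M,N)\in Red(T)$ such that $T_M$ is semi-Fredholm and $T_N$ is meromorphic. Then $T$ is quasi B-Fredholm if and only if $T$ is B-Fredholm. Moreover, in this case the index of $T$ as a quasi B-Fredholm operator is well defined and coincides with its index as a B-Fredholm operator: decompositions $(M,N)\in Red(T)$ with $T_M$ semi-Fredholm and $T_N$ meromorphic exist, and for each of them $$\alpha(T_M)-\beta(T_M)=\alpha(T_{[m_T]})-\beta(T_{[m_T]}).$$ 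-/

import Mathlib

namespace BFredholm

noncomputable section

variable {X : Type*} [NormedAddCommGroup X] [NormedSpace ℂ X]

/-- `α(T)`, the dimension of the kernel of `T` (`⊤` if it is infinite). -/
def alpha (T : X →L[ℂ] X) : ℕ∞ := Cardinal.toENat (Module.rank ℂ T.ker)

/-- `β(T)`, the (algebraic) codimension of the range of `T` (`⊤` if it is infinite). -/
def beta (T : X →L[ℂ] X) : ℕ∞ := Cardinal.toENat (Module.rank ℂ (X ⧸ T.range))

theorem apply_mem_range_pow (T : X →L[ℂ] X) (n : ℕ) :
    ∀ x ∈ (T ^ n).range, T x ∈ (T ^ n).range := by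
  rintro x ⟨y, rfl⟩
  refine ⟨T y, ?_⟩
  change (T ^ n * T) y = (T * T ^ n) y
  rw [← pow_succ, ← pow_succ']

/-- `T_[n]`, the restriction of `T` to the range of `T ^ n`, as an operator on that range. -/
def iter (T : X →L[ℂ] X) (n : ℕ) : (T ^ n).range →L[ℂ] (T ^ n).range :=
  T.restrict (apply_mem_range_pow T n)

/-- The essential ascent `a_e(T) = inf {n : α(T_[n]) < ∞}`, with `inf ∅ = ∞`. -/
def essAscent (T : X →L[ℂ] X) : ℕ∞ :=
  ⨅ (n : ℕ) (_ : alpha (iter T n) < ⊤), (n : ℕ∞)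

/-- The essential descent `d_e(T) = inf {n : β(T_[n]) < ∞}`, with `inf ∅ = ∞`. -/
def essDescent (T : X →L[ℂ] X) : ℕ∞ :=
  ⨅ (n : ℕ) (_ : beta (iter T n) < ⊤), (n : ℕ∞)

/-- The essential degree `m_T = inf {n : min (α(T_[n])) (β(T_[n])) < ∞}`, with `inf ∅ = ∞`. -/
def essDegree (T : X →L[ℂ] X) : ℕ∞ :=
  ⨅ (n : ℕ) (_ : min (alpha (iter T n)) (beta (iter T n)) < ⊤), (n : ℕ∞)

/-- `a_e(T) < ∞` and the range of `T ^ (a_e(T) + 1)` is closed. -/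
def IsUpperSemiBFredholm (T : X →L[ℂ] X) : Prop :=
  ∃ a : ℕ, essAscent T = a ∧ IsClosed ((T ^ (a + 1)).range : Set X)

/-- `d_e(T) < ∞` and the range of `T ^ (d_e(T))` is closed. -/
def IsLowerSemiBFredholm (T : X →L[ℂ] X) : Prop :=
  ∃ d : ℕ, essDescent T = d ∧ IsClosed ((T ^ d).range : Set X)

def IsBFredholm (T : X →L[ℂ] X) : Prop :=
  IsUpperSemiBFredholm T ∧ IsLowerSemiBFredholm T

def IsUpperSemiFredholm (T : X →L[ℂ] X) : Prop :=
  IsUpperSemiBFredholm T ∧ essDegree T = 0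

def IsLowerSemiFredholm (T : X →L[ℂ] X) : Prop :=
  IsLowerSemiBFredholm T ∧ essDegree T = 0

def IsSemiFredholm (T : X →L[ℂ] X) : Prop :=
  IsUpperSemiFredholm T ∨ IsLowerSemiFredholm T

/-- `α(T) - β(T)`, the usual index of a semi-Fredholm operator; it is an integer or `±∞`.
(For semi-Fredholm operators `α(T)` and `β(T)` are not both infinite.) -/
def semiFredholmIndex (T : X →L[ℂ] X) : EReal :=
  ((alpha T : ENNReal) : EReal) - ((beta T : ENNReal) : EReal)

/-- `α(T_[m]) - β(T_[m])` with `m = m_T`, the usual index of a B-Fredholm operator.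
(For such operators the essential degree `m_T` is finite.) -/
def bFredholmIndex (T : X →L[ℂ] X) : EReal :=
  semiFredholmIndex (iter T (essDegree T).toNat)

/-- `(M, N) ∈ Red(T)`: the closed `T`-invariant subspaces `M` and `N` satisfy `X = M ⊕ N`. -/
structure IsRed (T : X →L[ℂ] X) (M N : Submodule ℂ X) : Prop where
  isClosed_left : IsClosed (M : Set X)
  isClosed_right : IsClosed (N : Set X)
  mapsTo_left : ∀ x ∈ M, T x ∈ M
  mapsTo_right : ∀ x ∈ N, T x ∈ N
  isCompl : IsCompl M N

/-- The restriction `T_M`, for `(M, N) ∈ Red(T)`. -/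
def IsRed.left {T : X →L[ℂ] X} {M N : Submodule ℂ X} (h : IsRed T M N) : M →L[ℂ] M :=
  T.restrict h.mapsTo_left

/-- The restriction `T_N`, for `(M, N) ∈ Red(T)`. -/
def IsRed.right {T : X →L[ℂ] X} {M N : Submodule ℂ X} (h : IsRed T M N) : N →L[ℂ] N :=
  T.restrict h.mapsTo_right

def IsQuasiUpperSemiBFredholm (T : X →L[ℂ] X) : Prop :=
  ∃ (M N : Submodule ℂ X) (h : IsRed T M N), IsUpperSemiFredholm h.left ∧ IsNilpotent h.right

def IsQuasiLowerSemiBFredholm (T : X →L[ℂ] X) : Prop :=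
  ∃ (M N : Submodule ℂ X) (h : IsRed T M N), IsLowerSemiFredholm h.left ∧ IsNilpotent h.right

/-- The two decompositions may be different. -/
def IsQuasiBFredholm (T : X →L[ℂ] X) : Prop :=
  IsQuasiUpperSemiBFredholm T ∧ IsQuasiLowerSemiBFredholm T

/-- `T` is the direct sum of an invertible operator and a nilpotent operator. -/
def IsDrazinInvertible (T : X →L[ℂ] X) : Prop :=
  ∃ (M N : Submodule ℂ X) (h : IsRed T M N), IsUnit h.left ∧ IsNilpotent h.right

/-- `T - λ I` is Drazin invertible for every `λ ≠ 0`. Nilpotent operators are meromorphic. -/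
def IsMeromorphic (T : X →L[ℂ] X) : Prop :=
  ∀ z : ℂ, z ≠ 0 → IsDrazinInvertible (T - z • (1 : X →L[ℂ] X))

/-- `k` is an index of `T` in the sense of decompositions: `T = T₁ ⊕ T₂` with `T₁` semi-Fredholm
of index `k` and `T₂` meromorphic. The index of a quasi B-Fredholm operator is defined in this way;
that there is exactly one such `k` is part of the claim about it. -/
def IsDecompositionIndex (T : X →L[ℂ] X) (k : EReal) : Prop :=
  ∃ (M N : Submodule ℂ X) (h : IsRed T M N),
    IsSemiFredholm h.left ∧ IsMeromorphic h.right ∧ semiFredholmIndex h.left = k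

end

end BFredholm

/-! Everything is expressed through `nullity T n` and `defect T n`, which are α and β of the
restriction of `T` to R(Tⁿ). From `n` to `n + 1` both drop by the same amount
(`exists_nullity_defect_succ`), so their difference, when finite, does not depend on `n`. Both are
additive over `Red(T)`. By `isBFredholm_iff`, B-Fredholm means that at some single `n` both are
finite and R(Tⁿ) is closed. If `T` is quasi B-Fredholm, then at a large `n` the nilpotent summands
contribute nothing: one decomposition bounds the nullity and gives closedness of R(Tⁿ), the other
bounds the defect. Conversely, `exists_isRed_of_isBFredholm` builds a Kato decomposition with
Fredholm and nilpotent parts. For the index, a B-Fredholm meromorphic operator has index 0: for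
small `w ≠ 0` the index of `T - w` equals that of `T` (perturb the Fredholm part; the nilpotent part
becomes invertible), while a Drazin invertible operator has index 0. Additivity then gives ind(T) =
ind(T_M). -/

namespace BFredholm

noncomputable section

/-! ### Nullity, defect and index along the powers of a linear map. -/

section Algebra

universe u v

variable {K : Type v} [Field K] {V W W' : Type u} [AddCommGroup V] [Module K V]
  [AddCommGroup W] [Module K W] [AddCommGroup W'] [Module K W']

variable (K V) in
/-- The dimension of a vector space, as an extended natural number. -/
def edim : ℕ∞ := Cardinal.toENat (Module.rank K V)

theorem edim_congr (e : V ≃ₗ[K] W) : edim K V = edim K W := by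
  simp only [edim, e.rank_eq]

theorem edim_lt_top : edim K V < ⊤ ↔ Module.Finite K V := by
  rw [edim, Cardinal.toENat_lt_top, Module.rank_lt_aleph0_iff]

theorem edim_quotient_add (p : Submodule K V) : edim K (V ⧸ p) + edim K p = edim K V := by
  simp only [edim, ← map_add, rank_quotient_add_rank_of_divisionRing]

theorem edim_prod : edim K (V × W) = edim K V + edim K W := by
  simp only [edim, rank_prod', map_add]

theorem edim_range_add_ker (f : V →ₗ[K] W) :
    edim K f.range + edim K f.ker = edim K V := by
  simp only [edim, ← map_add, f.rank_range_add_rank_ker]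

theorem edim_quotient_eq_of_surjective (f : V →ₗ[K] W) (hf : Function.Surjective f)
    {p : Submodule K V} (hp : f.ker = p) : edim K (V ⧸ p) = edim K W := by
  subst hp
  exact edim_congr (f.quotKerEquivOfSurjective hf)

theorem edim_range_eq_of_ker_eq (f : V →ₗ[K] W) (g : V →ₗ[K] W') (h : f.ker = g.ker) :
    edim K f.range = edim K g.range := by
  rw [← edim_congr f.quotKerEquivRange, h, edim_congr g.quotKerEquivRange]

theorem edim_map_mkQ_add (p q : Submodule K V) :
    edim K (q.map p.mkQ) + edim K (p ⊓ q : Submodule K V) = edim K q := by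
  have h := edim_range_add_ker (p.mkQ ∘ₗ q.subtype)
  rw [LinearMap.range_comp, Submodule.range_subtype, LinearMap.ker_comp, Submodule.ker_mkQ] at h
  rw [← h, ← edim_congr (Submodule.comap_equiv_self_of_inj_of_le (f := q.subtype)
    (p := p ⊓ q) q.injective_subtype (by simp)), Submodule.comap_inf,
    Submodule.comap_subtype_self, inf_top_eq]

theorem edim_quotient_of_le {p q : Submodule K V} (h : p ≤ q) :
    edim K (V ⧸ p) = edim K (q.map p.mkQ) + edim K (V ⧸ q) := by
  rw [← edim_congr (Submodule.quotientQuotientEquivQuotient p q h), add_comm,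
    edim_quotient_add]

/-- The dimension of `N(T) ∩ R(Tⁿ)`. -/
def nullity (T : V →ₗ[K] V) (n : ℕ) : ℕ∞ := edim K (T.ker ⊓ (T ^ n).range : Submodule K V)

/-- The codimension of `R(T) + N(Tⁿ)`, which is the codimension of `R(Tⁿ⁺¹)` in `R(Tⁿ)`. -/
def defect (T : V →ₗ[K] V) (n : ℕ) : ℕ∞ := edim K (V ⧸ (T.range ⊔ (T ^ n).ker))

theorem mem_ker_pow_succ {T : V →ₗ[K] V} {n : ℕ} {x : V} :
    x ∈ (T ^ (n + 1)).ker ↔ (T ^ n) x ∈ T.ker := by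
  rw [LinearMap.mem_ker, LinearMap.mem_ker, pow_succ', Module.End.mul_apply]

theorem ker_pow_mono (T : V →ₗ[K] V) {m n : ℕ} (h : m ≤ n) : (T ^ m).ker ≤ (T ^ n).ker := by
  intro x hx
  obtain ⟨k, rfl⟩ := Nat.exists_eq_add_of_le' h
  rw [LinearMap.mem_ker] at hx ⊢
  rw [pow_add, Module.End.mul_apply, hx, map_zero]

theorem range_pow_anti (T : V →ₗ[K] V) {m n : ℕ} (h : m ≤ n) :
    (T ^ n).range ≤ (T ^ m).range := by
  rintro _ ⟨x, rfl⟩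
  obtain ⟨k, rfl⟩ := Nat.exists_eq_add_of_le h
  exact ⟨(T ^ k) x, by rw [pow_add, Module.End.mul_apply]⟩

/-- Both sides are the preimage of `R(Tⁿ⁺¹)` under `Tⁿ`. -/
theorem comap_pow_range_succ (T : V →ₗ[K] V) (n : ℕ) :
    (T ^ (n + 1)).range.comap (T ^ n) = T.range ⊔ (T ^ n).ker := by
  rw [← Submodule.comap_map_eq, ← LinearMap.range_comp, pow_succ]
  rfl

/-- `Tⁿ` maps N(Tⁿ⁺¹) onto N(T) ∩ R(Tⁿ) and pulls R(Tⁿ⁺¹) back to R(T) + N(Tⁿ). Hence the drop of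
the nullity and the drop of the defect are both the dimension of N(Tⁿ⁺¹) modulo R(T) + N(Tⁿ). -/
theorem exists_nullity_defect_succ (T : V →ₗ[K] V) (n : ℕ) :
    ∃ k, nullity T n = k + nullity T (n + 1) ∧ defect T n = k + defect T (n + 1) := by
  refine ⟨edim K ((T ^ (n + 1)).ker.map (T.range ⊔ (T ^ n).ker).mkQ), ?_, ?_⟩
  · have h := edim_map_mkQ_add ((T ^ (n + 1)).range) (T.ker ⊓ (T ^ n).range)
    have h1 : (T ^ (n + 1)).range ⊓ (T.ker ⊓ (T ^ n).range) = T.ker ⊓ (T ^ (n + 1)).range := by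
      have := range_pow_anti T (Nat.le_succ n)
      rw [inf_left_comm, inf_eq_left.2 this]
    have h2 : T.ker ⊓ (T ^ n).range = (T ^ (n + 1)).ker.map (T ^ n) := by
      rw [pow_succ', Module.End.mul_eq_comp, LinearMap.ker_comp, Submodule.map_comap_eq, inf_comm]
    rw [h1] at h
    rw [nullity, nullity, ← h, h2]
    congr 1
    have := edim_range_eq_of_ker_eq
      ((T ^ (n + 1)).range.mkQ ∘ₗ (T ^ n) ∘ₗ (T ^ (n + 1)).ker.subtype)
      ((T.range ⊔ (T ^ n).ker).mkQ ∘ₗ (T ^ (n + 1)).ker.subtype)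
      (by
        rw [← LinearMap.comp_assoc, LinearMap.ker_comp, LinearMap.ker_comp, LinearMap.ker_comp,
          Submodule.ker_mkQ, Submodule.ker_mkQ, comap_pow_range_succ])
    rw [LinearMap.range_comp, LinearMap.range_comp, LinearMap.range_comp,
      Submodule.range_subtype] at this
    exact this
  · have h : T.range ⊔ (T ^ n).ker ≤ T.range ⊔ (T ^ (n + 1)).ker :=
      sup_le_sup_left (ker_pow_mono T (Nat.le_succ n)) _
    rw [defect, defect, edim_quotient_of_le h]
    have : T.range ⊔ (T ^ (n + 1)).ker = (T.range ⊔ (T ^ n).ker) ⊔ (T ^ (n + 1)).ker := by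
      rw [sup_assoc, sup_eq_right.2 (ker_pow_mono T (Nat.le_succ n))]
    have h' : (T.range ⊔ (T ^ (n + 1)).ker).map (T.range ⊔ (T ^ n).ker).mkQ =
        (T ^ (n + 1)).ker.map (T.range ⊔ (T ^ n).ker).mkQ := by
      rw [this, Submodule.map_sup, Submodule.mkQ_map_self, bot_sup_eq]
    rw [h']

theorem exists_nullity_defect_of_le (T : V →ₗ[K] V) {m n : ℕ} (h : m ≤ n) :
    ∃ k, nullity T m = k + nullity T n ∧ defect T m = k + defect T n := by
  induction n, h using Nat.le_induction with
  | base => exact ⟨0, by simp, by simp⟩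
  | succ n _ ih =>
    obtain ⟨k, h1, h2⟩ := ih
    obtain ⟨l, h3, h4⟩ := exists_nullity_defect_succ T n
    exact ⟨k + l, by rw [h1, h3, add_assoc], by rw [h2, h4, add_assoc]⟩

theorem nullity_anti (T : V →ₗ[K] V) : Antitone (nullity T) := fun m n h => by
  obtain ⟨k, h1, -⟩ := exists_nullity_defect_of_le T h
  exact h1 ▸ le_add_self

theorem defect_anti (T : V →ₗ[K] V) : Antitone (defect T) := fun m n h => by
  obtain ⟨k, -, h1⟩ := exists_nullity_defect_of_le T h
  exact h1 ▸ le_add_self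

/-- The common drop from `m` to `max m n` is bounded by the nullity at `m`, and what remains of the
defect is bounded by its value at `n`. -/
theorem defect_lt_top_of_nullity_lt_top (T : V →ₗ[K] V) {m n : ℕ} (hm : nullity T m < ⊤)
    (hn : defect T n < ⊤) : defect T m < ⊤ := by
  obtain ⟨k, h1, h2⟩ := exists_nullity_defect_of_le T (le_max_left m n)
  rw [h1, ENat.add_lt_top] at hm
  rw [h2, ENat.add_lt_top]
  exact ⟨hm.1, (defect_anti T (le_max_right m n)).trans_lt hn⟩

theorem nullity_lt_top_of_defect_lt_top (T : V →ₗ[K] V) {m n : ℕ} (hm : defect T m < ⊤)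
    (hn : nullity T n < ⊤) : nullity T m < ⊤ := by
  obtain ⟨k, h1, h2⟩ := exists_nullity_defect_of_le T (le_max_left m n)
  rw [h2, ENat.add_lt_top] at hm
  rw [h1, ENat.add_lt_top]
  exact ⟨hm.1, (nullity_anti T (le_max_right m n)).trans_lt hn⟩

theorem semiconj_pow {T : V →ₗ[K] V} {S : W →ₗ[K] W} (e : V ≃ₗ[K] W)
    (h : ∀ x, e (T x) = S (e x)) (n : ℕ) (x : V) : e ((T ^ n) x) = (S ^ n) (e x) := by
  induction n generalizing x with
  | zero => rfl
  | succ n ih => rw [pow_succ, pow_succ, Module.End.mul_apply, Module.End.mul_apply, ih, h]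

theorem range_eq_of_semiconj {T : V →ₗ[K] V} {S : W →ₗ[K] W} (e : V ≃ₗ[K] W)
    (h : ∀ x, e (T x) = S (e x)) : T.range = S.range.comap (e : V →ₗ[K] W) := by
  ext x
  constructor
  · rintro ⟨y, rfl⟩
    exact ⟨e y, (h y).symm⟩
  · rintro ⟨y, hy⟩
    refine ⟨e.symm y, e.injective ?_⟩
    rw [h, e.apply_symm_apply, hy]
    rfl

theorem ker_eq_of_semiconj {T : V →ₗ[K] V} {S : W →ₗ[K] W} (e : V ≃ₗ[K] W)
    (h : ∀ x, e (T x) = S (e x)) : T.ker = S.ker.comap (e : V →ₗ[K] W) := by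
  ext x
  simp [← h]

theorem nullity_eq_of_semiconj {T : V →ₗ[K] V} {S : W →ₗ[K] W} (e : V ≃ₗ[K] W)
    (h : ∀ x, e (T x) = S (e x)) (n : ℕ) : nullity T n = nullity S n := by
  rw [nullity, nullity, ker_eq_of_semiconj e h, range_eq_of_semiconj e (semiconj_pow e h n),
    ← Submodule.comap_inf]
  exact edim_congr (e.ofSubmodule' _)

theorem defect_eq_of_semiconj {T : V →ₗ[K] V} {S : W →ₗ[K] W} (e : V ≃ₗ[K] W)
    (h : ∀ x, e (T x) = S (e x)) (n : ℕ) : defect T n = defect S n := by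
  rw [defect, defect]
  refine edim_congr (Submodule.Quotient.equiv _ _ e ?_)
  rw [range_eq_of_semiconj e h, ker_eq_of_semiconj e (semiconj_pow e h n), Submodule.map_sup,
    Submodule.map_comap_eq_of_surjective e.surjective,
    Submodule.map_comap_eq_of_surjective e.surjective]

theorem edim_submodule_prod (p : Submodule K V) (q : Submodule K W) :
    edim K (p.prod q) = edim K p + edim K q := by
  rw [← edim_prod]
  have h := edim_congr (LinearEquiv.ofInjective (p.subtype.prodMap q.subtype)
    (Function.Injective.prodMap p.injective_subtype q.injective_subtype))
  rw [LinearMap.range_prodMap, Submodule.range_subtype, Submodule.range_subtype] at h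
  exact h.symm

theorem prodMap_pow (T : V →ₗ[K] V) (S : W →ₗ[K] W) (n : ℕ) :
    (T.prodMap S) ^ n = (T ^ n).prodMap (S ^ n) := by
  induction n with
  | zero => exact LinearMap.prodMap_one.symm
  | succ n ih => rw [pow_succ, pow_succ, pow_succ, ih, LinearMap.prodMap_mul]

theorem nullity_prodMap (T : V →ₗ[K] V) (S : W →ₗ[K] W) (n : ℕ) :
    nullity (T.prodMap S) n = nullity T n + nullity S n := by
  rw [nullity, prodMap_pow, LinearMap.ker_prodMap, LinearMap.range_prodMap,
    Submodule.prod_inf_prod, edim_submodule_prod]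
  rfl

theorem defect_prodMap (T : V →ₗ[K] V) (S : W →ₗ[K] W) (n : ℕ) :
    defect (T.prodMap S) n = defect T n + defect S n := by
  rw [defect, prodMap_pow, LinearMap.ker_prodMap, LinearMap.range_prodMap,
    Submodule.prod_sup_prod, defect, defect, ← edim_prod]
  refine edim_quotient_eq_of_surjective
    ((T.range ⊔ (T ^ n).ker).mkQ.prodMap (S.range ⊔ (S ^ n).ker).mkQ) ?_ ?_
  · exact Function.Surjective.prodMap (Submodule.mkQ_surjective _) (Submodule.mkQ_surjective _)
  · rw [LinearMap.ker_prodMap, Submodule.ker_mkQ, Submodule.ker_mkQ]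

/-- `i` is the index of `T`, as computed on the range of some power of `T`. -/
def HasIndex (T : V →ₗ[K] V) (i : ℤ) : Prop :=
  ∃ n a b : ℕ, nullity T n = a ∧ defect T n = b ∧ i = a - b

theorem HasIndex.exists_of_le {T : V →ₗ[K] V} {i : ℤ} {n a b : ℕ} (ha : nullity T n = a)
    (hb : defect T n = b) (hi : i = a - b) {m : ℕ} (h : n ≤ m) :
    ∃ a b : ℕ, nullity T m = a ∧ defect T m = b ∧ i = a - b := by
  obtain ⟨k, h1, h2⟩ := exists_nullity_defect_of_le T h
  have h3 : nullity T m < ⊤ := (nullity_anti T h).trans_lt (by simp [ha])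
  have h4 : defect T m < ⊤ := (defect_anti T h).trans_lt (by simp [hb])
  have h5 : k < ⊤ := (ENat.add_lt_top.1 (h1 ▸ ha ▸ ENat.natCast_lt_top a)).1
  lift k to ℕ using h5.ne
  obtain ⟨a', ha'⟩ := ENat.ne_top_iff_exists.1 h3.ne
  obtain ⟨b', hb'⟩ := ENat.ne_top_iff_exists.1 h4.ne
  refine ⟨a', b', ha'.symm, hb'.symm, ?_⟩
  rw [ha, ← ha'] at h1
  rw [hb, ← hb'] at h2
  norm_cast at h1 h2
  omega

theorem HasIndex.eventually {T : V →ₗ[K] V} {i : ℤ} (h : HasIndex T i) :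
    ∃ n : ℕ, ∀ m ≥ n, ∃ a b : ℕ, nullity T m = a ∧ defect T m = b ∧ i = a - b := by
  obtain ⟨n, a, b, ha, hb, hi⟩ := h
  exact ⟨n, fun m hm => HasIndex.exists_of_le ha hb hi hm⟩

theorem HasIndex.eq_sub {T : V →ₗ[K] V} {i : ℤ} (h : HasIndex T i) {n a b : ℕ}
    (ha : nullity T n = a) (hb : defect T n = b) : i = a - b := by
  obtain ⟨m, hm⟩ := h.eventually
  obtain ⟨a', b', ha', hb', hi⟩ := hm _ (le_max_left m n)
  obtain ⟨a'', b'', ha'', hb'', hi'⟩ := HasIndex.exists_of_le ha hb rfl (le_max_right m n)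
  rw [ha'] at ha''
  rw [hb'] at hb''
  norm_cast at ha'' hb''
  omega

theorem HasIndex.unique {T : V →ₗ[K] V} {i j : ℤ} (h : HasIndex T i) (h' : HasIndex T j) :
    i = j := by
  obtain ⟨n, a, b, ha, hb, hi⟩ := h'
  rw [hi, h.eq_sub ha hb]

theorem exists_hasIndex {T : V →ₗ[K] V} {n : ℕ} (h1 : nullity T n < ⊤) (h2 : defect T n < ⊤) :
    ∃ i, HasIndex T i := by
  obtain ⟨a, ha⟩ := ENat.ne_top_iff_exists.1 h1.ne
  obtain ⟨b, hb⟩ := ENat.ne_top_iff_exists.1 h2.ne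
  exact ⟨a - b, n, a, b, ha.symm, hb.symm, rfl⟩

theorem HasIndex.add {T : V →ₗ[K] V} {S : W →ₗ[K] W} {U : W' →ₗ[K] W'} {i j : ℤ}
    (hn : ∀ n, nullity U n = nullity T n + nullity S n)
    (hd : ∀ n, defect U n = defect T n + defect S n)
    (hT : HasIndex T i) (hS : HasIndex S j) : HasIndex U (i + j) := by
  obtain ⟨m, hm⟩ := hT.eventually
  obtain ⟨n, hn'⟩ := hS.eventually
  obtain ⟨a, b, ha, hb, hi⟩ := hm _ (le_max_left m n)
  obtain ⟨a', b', ha', hb', hj⟩ := hn' _ (le_max_right m n)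
  refine ⟨max m n, a + a', b + b', by rw [hn, ha, ha']; rfl, by rw [hd, hb, hb']; rfl, ?_⟩
  push_cast
  omega

theorem hasIndex_zero_of_injective_of_surjective {T : V →ₗ[K] V} (h1 : Function.Injective T)
    (h2 : Function.Surjective T) : HasIndex T 0 := by
  refine ⟨0, 0, 0, ?_, ?_, by simp⟩
  · rw [nullity, LinearMap.ker_eq_bot.2 h1, bot_inf_eq]
    simp [edim]
  · rw [defect, LinearMap.range_eq_top.2 h2, top_sup_eq]
    simp [edim]

theorem hasIndex_zero_of_isNilpotent {T : V →ₗ[K] V} (h : IsNilpotent T) : HasIndex T 0 := by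
  obtain ⟨n, hn⟩ := h
  refine ⟨n, 0, 0, ?_, ?_, by simp⟩
  · rw [nullity, hn, LinearMap.range_zero, inf_bot_eq]
    simp [edim]
  · rw [defect, hn, LinearMap.ker_zero, sup_top_eq]
    simp [edim]

end Algebra

/-! ### The definitions in terms of nullity and defect; nilpotent and Drazin invertible operators.
-/

section Normed

universe u

variable {X : Type u} [NormedAddCommGroup X] [NormedSpace ℂ X]

theorem alpha_iter (T : X →L[ℂ] X) (n : ℕ) : alpha (iter T n) = nullity (T : X →ₗ[ℂ] X) n := by
  rw [nullity, ← ContinuousLinearMap.toLinearMap_pow]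
  refine Eq.trans ?_ (edim_congr (Submodule.comap_equiv_self_of_inj_of_le
    (f := (T ^ n).range.subtype) (p := T.ker ⊓ (T ^ n).range) (Submodule.injective_subtype _)
    (by simp)))
  have : (iter T n).ker = (T.ker ⊓ (T ^ n).range).comap (T ^ n).range.subtype := by
    ext x
    simp [iter, Subtype.ext_iff]
  rw [alpha, this, edim]

/-- `Tⁿ` induces a surjection of X onto R(Tⁿ)/R(Tⁿ⁺¹) with kernel R(T) + N(Tⁿ). -/
theorem beta_iter (T : X →L[ℂ] X) (n : ℕ) : beta (iter T n) = defect (T : X →ₗ[ℂ] X) n := by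
  rw [defect, ← comap_pow_range_succ]
  refine (edim_quotient_eq_of_surjective
    ((iter T n).range.mkQ ∘ₗ (T ^ n : X →L[ℂ] X).toLinearMap.rangeRestrict) ?_ ?_).symm
  · exact (Submodule.mkQ_surjective _).comp (LinearMap.surjective_rangeRestrict _)
  · rw [LinearMap.ker_comp, Submodule.ker_mkQ, ← ContinuousLinearMap.toLinearMap_pow,
      ← ContinuousLinearMap.toLinearMap_pow]
    ext x
    simp only [Submodule.mem_comap, LinearMap.mem_range, ContinuousLinearMap.coe_coe]
    constructor
    · rintro ⟨⟨_, y, rfl⟩, hy⟩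
      refine ⟨y, ?_⟩
      rw [pow_succ']
      exact congrArg Subtype.val hy
    · rintro ⟨y, hy⟩
      refine ⟨⟨(T ^ n) y, y, rfl⟩, Subtype.ext ?_⟩
      rw [pow_succ'] at hy
      exact hy

theorem alpha_eq_nullity (T : X →L[ℂ] X) : alpha T = nullity (T : X →ₗ[ℂ] X) 0 := by
  rw [nullity, pow_zero, Module.End.one_eq_id, LinearMap.range_id, inf_top_eq]
  rfl

theorem beta_eq_defect (T : X →L[ℂ] X) : beta T = defect (T : X →ₗ[ℂ] X) 0 := by
  rw [defect, pow_zero, Module.End.one_eq_id, LinearMap.ker_id, sup_bot_eq]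
  rfl

theorem iInf_natCast_eq_iff (P : ℕ → Prop) (a : ℕ) :
    (⨅ (n : ℕ) (_ : P n), (n : ℕ∞)) = a ↔ P a ∧ ∀ n, P n → a ≤ n := by
  have key : ∀ b : ℕ, P b → (∀ n, P n → b ≤ n) → (⨅ (n : ℕ) (_ : P n), (n : ℕ∞)) = b := by
    intro b hb hle
    refine le_antisymm (iInf₂_le b hb) (le_iInf₂ fun n hn => ?_)
    exact_mod_cast hle n hn
  refine ⟨fun h => ?_, fun h => key a h.1 h.2⟩
  by_cases hP : ∃ n, P n
  · classical
    have h1 := key (Nat.find hP) (Nat.find_spec hP) fun n hn => Nat.find_min' hP hn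
    rw [h] at h1
    norm_cast at h1
    subst h1
    exact ⟨Nat.find_spec hP, fun n hn => Nat.find_min' hP hn⟩
  · push Not at hP
    simp [hP] at h

theorem essAscent_eq_iff (T : X →L[ℂ] X) (a : ℕ) : essAscent T = a ↔
    nullity (T : X →ₗ[ℂ] X) a < ⊤ ∧ ∀ n, nullity (T : X →ₗ[ℂ] X) n < ⊤ → a ≤ n := by
  simp only [essAscent, iInf_natCast_eq_iff, alpha_iter]

theorem essDescent_eq_iff (T : X →L[ℂ] X) (a : ℕ) : essDescent T = a ↔
    defect (T : X →ₗ[ℂ] X) a < ⊤ ∧ ∀ n, defect (T : X →ₗ[ℂ] X) n < ⊤ → a ≤ n := by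
  simp only [essDescent, iInf_natCast_eq_iff, beta_iter]

theorem essDegree_eq_iff (T : X →L[ℂ] X) (a : ℕ) : essDegree T = a ↔
    (nullity (T : X →ₗ[ℂ] X) a < ⊤ ∨ defect (T : X →ₗ[ℂ] X) a < ⊤) ∧
      ∀ n, (nullity (T : X →ₗ[ℂ] X) n < ⊤ ∨ defect (T : X →ₗ[ℂ] X) n < ⊤) → a ≤ n := by
  simp only [essDegree, iInf_natCast_eq_iff, alpha_iter, beta_iter, min_lt_iff]

theorem isUpperSemiFredholm_iff (T : X →L[ℂ] X) :
    IsUpperSemiFredholm T ↔ nullity (T : X →ₗ[ℂ] X) 0 < ⊤ ∧ IsClosed (T.range : Set X) := by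
  constructor
  · rintro ⟨⟨a, ha, hc⟩, hd⟩
    rw [essAscent_eq_iff] at ha
    rw [← Nat.cast_zero, essDegree_eq_iff] at hd
    have h0 : nullity (T : X →ₗ[ℂ] X) 0 < ⊤ :=
      hd.1.elim id fun h => nullity_lt_top_of_defect_lt_top _ h ha.1
    obtain rfl : a = 0 := Nat.le_zero.1 (ha.2 0 h0)
    rw [zero_add, pow_one] at hc
    exact ⟨h0, hc⟩
  · rintro ⟨h0, hc⟩
    refine ⟨⟨0, (essAscent_eq_iff T 0).2 ⟨h0, fun n _ => n.zero_le⟩, ?_⟩,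
      (essDegree_eq_iff T 0).2 ⟨Or.inl h0, fun n _ => n.zero_le⟩⟩
    rwa [zero_add, pow_one]

/-- Here the essential descent is 0, so the closedness condition concerns R(T⁰) = X and is void. -/
theorem isLowerSemiFredholm_iff (T : X →L[ℂ] X) :
    IsLowerSemiFredholm T ↔ defect (T : X →ₗ[ℂ] X) 0 < ⊤ := by
  constructor
  · rintro ⟨⟨a, ha, hc⟩, hd⟩
    rw [essDescent_eq_iff] at ha
    rw [← Nat.cast_zero, essDegree_eq_iff] at hd
    exact hd.1.elim (fun h => defect_lt_top_of_nullity_lt_top _ h ha.1) id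
  · intro h0
    refine ⟨⟨0, (essDescent_eq_iff T 0).2 ⟨h0, fun n _ => n.zero_le⟩, ?_⟩,
      (essDegree_eq_iff T 0).2 ⟨Or.inr h0, fun n _ => n.zero_le⟩⟩
    have : (T ^ 0).range = ⊤ := by
      rw [pow_zero, LinearMap.range_eq_top]
      exact Function.surjective_id
    rw [this]
    exact isClosed_univ

theorem IsRed.semiconj {T : X →L[ℂ] X} {M N : Submodule ℂ X} (h : IsRed T M N) (x : M × N) :
    Submodule.prodEquivOfIsCompl M N h.isCompl
      ((h.left : M →ₗ[ℂ] M).prodMap (h.right : N →ₗ[ℂ] N) x) =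
    (T : X →ₗ[ℂ] X) (Submodule.prodEquivOfIsCompl M N h.isCompl x) := by
  simp [IsRed.left, IsRed.right]

theorem IsRed.nullity_eq {T : X →L[ℂ] X} {M N : Submodule ℂ X} (h : IsRed T M N) (n : ℕ) :
    nullity (T : X →ₗ[ℂ] X) n =
      nullity (h.left : M →ₗ[ℂ] M) n + nullity (h.right : N →ₗ[ℂ] N) n := by
  rw [← nullity_prodMap, nullity_eq_of_semiconj _ h.semiconj]

theorem IsRed.defect_eq {T : X →L[ℂ] X} {M N : Submodule ℂ X} (h : IsRed T M N) (n : ℕ) :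
    defect (T : X →ₗ[ℂ] X) n =
      defect (h.left : M →ₗ[ℂ] M) n + defect (h.right : N →ₗ[ℂ] N) n := by
  rw [← defect_prodMap, defect_eq_of_semiconj _ h.semiconj]

theorem IsRed.hasIndex {T : X →L[ℂ] X} {M N : Submodule ℂ X} (h : IsRed T M N) {i j : ℤ}
    (hi : HasIndex (h.left : M →ₗ[ℂ] M) i) (hj : HasIndex (h.right : N →ₗ[ℂ] N) j) :
    HasIndex (T : X →ₗ[ℂ] X) (i + j) :=
  hi.add h.nullity_eq h.defect_eq hj

theorem restrict_pow_apply (T : X →L[ℂ] X) {M : Submodule ℂ X} (h : ∀ x ∈ M, T x ∈ M) (n : ℕ)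
    (x : M) : (((T.restrict h) ^ n) x : X) = (T ^ n) x := by
  induction n generalizing x with
  | zero => rfl
  | succ n ih => rw [pow_succ, pow_succ, mul_apply_eq_comp, ih]; rfl

theorem isNilpotent_toLinearMap {T : X →L[ℂ] X} (h : IsNilpotent T) :
    IsNilpotent (T : X →ₗ[ℂ] X) := by
  obtain ⟨n, hn⟩ := h
  exact ⟨n, by rw [← ContinuousLinearMap.toLinearMap_pow, hn]; rfl⟩

theorem hasIndex_zero_of_isUnit {T : X →L[ℂ] X} (h : IsUnit T) : HasIndex (T : X →ₗ[ℂ] X) 0 := by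
  obtain ⟨u, rfl⟩ := h
  refine hasIndex_zero_of_injective_of_surjective ?_ ?_
  · refine Function.LeftInverse.injective (g := (↑u⁻¹ : X →L[ℂ] X)) fun x => ?_
    exact DFunLike.congr_fun u.inv_mul x
  · refine Function.RightInverse.surjective (g := (↑u⁻¹ : X →L[ℂ] X)) fun x => ?_
    exact DFunLike.congr_fun u.mul_inv x

theorem IsDrazinInvertible.hasIndex_zero {T : X →L[ℂ] X} (h : IsDrazinInvertible T) :
    HasIndex (T : X →ₗ[ℂ] X) 0 := by
  obtain ⟨M, N, h, h1, h2⟩ := h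
  exact h.hasIndex (hasIndex_zero_of_isUnit h1)
    (hasIndex_zero_of_isNilpotent (isNilpotent_toLinearMap h2))

theorem isUnit_sub_smul_one_of_isNilpotent {T : X →L[ℂ] X} (h : IsNilpotent T) {z : ℂ}
    (hz : z ≠ 0) : IsUnit (T - z • (1 : X →L[ℂ] X)) := by
  have h1 : IsUnit (-(z • (1 : X →L[ℂ] X))) := by
    rw [← Algebra.algebraMap_eq_smul_one]
    exact ((IsUnit.mk0 z hz).map (algebraMap ℂ (X →L[ℂ] X))).neg
  have h2 := h.isUnit_add_left_of_commute h1
    (((Commute.one_right T).smul_right z).neg_right)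
  rwa [neg_add_eq_sub] at h2

theorem isRed_top_bot (T : X →L[ℂ] X) : IsRed T ⊤ ⊥ where
  isClosed_left := isClosed_univ
  isClosed_right := isClosed_singleton
  mapsTo_left := fun _ _ => trivial
  mapsTo_right := by simp
  isCompl := isCompl_top_bot

theorem isMeromorphic_of_isNilpotent {T : X →L[ℂ] X} (h : IsNilpotent T) : IsMeromorphic T := by
  intro z hz
  obtain ⟨u, hu⟩ := isUnit_sub_smul_one_of_isNilpotent h hz
  have h1 : ∀ x, (T - z • (1 : X →L[ℂ] X)) ((↑u⁻¹ : X →L[ℂ] X) x) = x := fun x => by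
    rw [← hu]
    exact DFunLike.congr_fun u.mul_inv x
  have h2 : ∀ x, (↑u⁻¹ : X →L[ℂ] X) ((T - z • (1 : X →L[ℂ] X)) x) = x := fun x => by
    rw [← hu]
    exact DFunLike.congr_fun u.inv_mul x
  refine ⟨⊤, ⊥, isRed_top_bot _, ?_, 1, ?_⟩
  · refine ⟨⟨(isRed_top_bot _).left,
      (↑u⁻¹ : X →L[ℂ] X).restrict (fun _ _ => trivial), ?_, ?_⟩, rfl⟩
    · ext x
      exact h1 x
    · ext x
      exact h2 x
  · exact Subsingleton.elim _ _

end Normed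

/-! ### Closedness of the ranges of powers. -/

section Banach

universe u

variable {X : Type u} [NormedAddCommGroup X] [NormedSpace ℂ X]

theorem exists_isCompl_finiteDimensional {K : Type*} [Field K] {V : Type u} [AddCommGroup V]
    [Module K V] {p : Submodule K V} (h : edim K (V ⧸ p) < ⊤) :
    ∃ q : Submodule K V, IsCompl p q ∧ FiniteDimensional K q := by
  obtain ⟨q, hq⟩ := p.exists_isCompl
  refine ⟨q, hq, ?_⟩
  rwa [edim_congr (p.quotientEquivOfIsCompl q hq), edim_lt_top] at h

/-- Adjoining a finite-dimensional complement `q` of the range gives a surjection `E × q → F`, a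
quotient map by the open mapping theorem; the preimage of the range is the closed set `E × {0}`. -/
theorem isClosed_range_of_edim_quotient_lt_top {E F : Type u} [NormedAddCommGroup E]
    [NormedSpace ℂ E] [CompleteSpace E] [NormedAddCommGroup F] [NormedSpace ℂ F] [CompleteSpace F]
    (S : E →L[ℂ] F) (h : edim ℂ (F ⧸ S.range) < ⊤) : IsClosed (S.range : Set F) := by
  obtain ⟨q, hq, hfin⟩ := exists_isCompl_finiteDimensional h
  have hsurj : Function.Surjective (S.coprod q.subtypeL) := by
    intro y
    obtain ⟨_, ⟨x, rfl⟩, z, hz, rfl⟩ :=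
      Submodule.mem_sup.1 (hq.sup_eq_top ▸ Submodule.mem_top (x := y))
    exact ⟨(x, ⟨z, hz⟩), by simp⟩
  rw [← (ContinuousLinearMap.isQuotientMap _ hsurj).isClosed_preimage]
  have : S.coprod q.subtypeL ⁻¹' (S.range : Set F) = Prod.snd ⁻¹' {(0 : q)} := by
    ext ⟨x, z⟩
    simp only [Set.mem_preimage, SetLike.mem_coe, Set.mem_singleton_iff]
    constructor
    · rintro ⟨y, hy⟩
      refine Subtype.ext (Submodule.disjoint_def.1 hq.disjoint _ ⟨y - x, ?_⟩ z.2)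
      rw [map_sub, hy]
      simp
    · rintro rfl
      exact ⟨x, by simp⟩
  rw [this]
  exact isClosed_singleton.preimage continuous_snd

/-- Onto its closed range `S` is a quotient map, and the preimage of `S(p)` is `p + ker S`, closed
because `ker S` is finite-dimensional. -/
theorem isClosed_map_of_isClosed_range {E F : Type u} [NormedAddCommGroup E]
    [NormedSpace ℂ E] [CompleteSpace E] [NormedAddCommGroup F] [NormedSpace ℂ F] [CompleteSpace F]
    (S : E →L[ℂ] F) (hr : IsClosed (S.range : Set F)) [FiniteDimensional ℂ S.ker]
    {p : Submodule ℂ E} (hp : IsClosed (p : Set E)) :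
    IsClosed (p.map (S : E →ₗ[ℂ] F) : Set F) := by
  have : CompleteSpace S.range := hr.completeSpace_coe
  have hq := ContinuousLinearMap.isQuotientMap S.rangeRestrict
    (LinearMap.surjective_rangeRestrict (S : E →ₗ[ℂ] F))
  have h1 : IsClosed (p.map (S.rangeRestrict : E →ₗ[ℂ] S.range) : Set S.range) := by
    rw [← hq.isClosed_preimage]
    have h2 := Submodule.isClosed_sup_finiteDimensional p S.ker hp
    have h3 : (p.map (S.rangeRestrict : E →ₗ[ℂ] S.range)).comap
        (S.rangeRestrict : E →ₗ[ℂ] S.range) = p ⊔ S.ker := by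
      rw [Submodule.comap_map_eq]
      congr 1
      exact LinearMap.ker_rangeRestrict _
    rw [← h3] at h2
    exact h2
  have h4 := (hr.isClosedEmbedding_subtypeVal).isClosedMap _ h1
  convert h4 using 1
  ext y
  simp only [Submodule.map_coe, Set.mem_image]
  constructor
  · rintro ⟨x, hx, rfl⟩
    exact ⟨_, ⟨x, hx, rfl⟩, rfl⟩
  · rintro ⟨_, ⟨x, hx, rfl⟩, rfl⟩
    exact ⟨x, hx, rfl⟩

theorem range_pow_succ (T : X →L[ℂ] X) (n : ℕ) :
    (T ^ (n + 1)).range = (T ^ n).range.map (T : X →ₗ[ℂ] X) := by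
  rw [pow_succ', ← LinearMap.range_comp]
  rfl

theorem isClosed_range_pow_of_isUpperSemiFredholm [CompleteSpace X] {T : X →L[ℂ] X}
    (h : IsUpperSemiFredholm T) (n : ℕ) : IsClosed ((T ^ n).range : Set X) := by
  obtain ⟨h0, hc⟩ := (isUpperSemiFredholm_iff T).1 h
  rw [nullity, pow_zero, Module.End.one_eq_id, LinearMap.range_id, inf_top_eq, edim_lt_top] at h0
  induction n with
  | zero =>
    have : (T ^ 0).range = ⊤ := by
      rw [pow_zero, LinearMap.range_eq_top]
      exact Function.surjective_id
    rw [this]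
    exact isClosed_univ
  | succ n ih =>
    rw [range_pow_succ]
    exact isClosed_map_of_isClosed_range T hc ih

theorem isClosed_range_pow_succ [CompleteSpace X] {T : X →L[ℂ] X} {n : ℕ}
    (hc : IsClosed ((T ^ n).range : Set X)) (hd : defect (T : X →ₗ[ℂ] X) n < ⊤) :
    IsClosed ((T ^ (n + 1)).range : Set X) := by
  have : CompleteSpace (T ^ n).range := hc.completeSpace_coe
  have h1 := isClosed_range_of_edim_quotient_lt_top (iter T n) (by rwa [← beta_iter] at hd)
  have h2 := (hc.isClosedEmbedding_subtypeVal).isClosedMap _ h1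
  convert h2 using 1
  ext y
  rw [range_pow_succ]
  constructor
  · rintro ⟨x, hx, rfl⟩
    exact ⟨_, ⟨⟨x, hx⟩, rfl⟩, rfl⟩
  · rintro ⟨_, ⟨⟨x, hx⟩, rfl⟩, rfl⟩
    exact ⟨x, hx, rfl⟩

/-- R(Tⁿ) is R(Tⁿ⁺¹) plus the image under `Tⁿ` of a finite-dimensional complement of R(T) + N(Tⁿ).
-/
theorem isClosed_range_pow_of_succ {T : X →L[ℂ] X} {n : ℕ}
    (hc : IsClosed ((T ^ (n + 1)).range : Set X)) (hd : defect (T : X →ₗ[ℂ] X) n < ⊤) :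
    IsClosed ((T ^ n).range : Set X) := by
  obtain ⟨q, hq, hfin⟩ := exists_isCompl_finiteDimensional hd
  have : (T ^ n).range = (T ^ (n + 1)).range ⊔ q.map (T ^ n : X →L[ℂ] X).toLinearMap := by
    apply le_antisymm
    · rw [LinearMap.range_eq_map, ← hq.sup_eq_top, Submodule.map_sup, Submodule.map_sup]
      refine sup_le_sup_right (sup_le ?_ ?_) _
      · rw [← LinearMap.range_comp, pow_succ]
        exact le_rfl
      · rw [← ContinuousLinearMap.toLinearMap_pow]
        rintro _ ⟨x, hx, rfl⟩
        rw [LinearMap.mem_ker.1 hx]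
        exact zero_mem _
    · refine sup_le ?_ (LinearMap.map_le_range)
      rw [ContinuousLinearMap.toLinearMap_pow, ContinuousLinearMap.toLinearMap_pow]
      exact range_pow_anti _ n.le_succ
  rw [this]
  exact Submodule.isClosed_sup_finiteDimensional _ _ hc

theorem isClosed_range_pow_of_le {T : X →L[ℂ] X} {m n : ℕ} (h : m ≤ n)
    (hc : IsClosed ((T ^ n).range : Set X)) (hd : defect (T : X →ₗ[ℂ] X) m < ⊤) :
    IsClosed ((T ^ m).range : Set X) := by
  induction n, h using Nat.le_induction with
  | base => exact hc
  | succ n hmn ih =>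
    exact ih (isClosed_range_pow_of_succ hc ((defect_anti _ hmn).trans_lt hd))

theorem isClosed_range_pow_of_ge [CompleteSpace X] {T : X →L[ℂ] X} {m n : ℕ} (h : m ≤ n)
    (hc : IsClosed ((T ^ m).range : Set X)) (hd : defect (T : X →ₗ[ℂ] X) m < ⊤) :
    IsClosed ((T ^ n).range : Set X) := by
  induction n, h using Nat.le_induction with
  | base => exact hc
  | succ n hmn ih => exact isClosed_range_pow_succ ih ((defect_anti _ hmn).trans_lt hd)

theorem isBFredholm_iff [CompleteSpace X] (T : X →L[ℂ] X) : IsBFredholm T ↔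
    ∃ n, nullity (T : X →ₗ[ℂ] X) n < ⊤ ∧ defect (T : X →ₗ[ℂ] X) n < ⊤ ∧
      IsClosed ((T ^ n).range : Set X) := by
  constructor
  · rintro ⟨⟨a, ha, -⟩, ⟨d, hd, hc⟩⟩
    rw [essAscent_eq_iff] at ha
    rw [essDescent_eq_iff] at hd
    exact ⟨d, nullity_lt_top_of_defect_lt_top _ hd.1 ha.1, hd.1, hc⟩
  · classical
    rintro ⟨n, h1, h2, hc⟩
    -- Finiteness of nullity and of defect now imply each other at every exponent, so the least `m`
    -- is both essential ascent and essential descent; closedness passes from `n` down to `m`, then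
    -- up to `m + 1`.
    have hex : ∃ m, nullity (T : X →ₗ[ℂ] X) m < ⊤ := ⟨n, h1⟩
    have hm := Nat.find_spec hex
    have hmin := fun k hk => Nat.find_min' hex (m := k) hk
    generalize Nat.find hex = m at hm hmin
    have hd := defect_lt_top_of_nullity_lt_top _ hm h2
    have hcm := isClosed_range_pow_of_le (hmin n h1) hc hd
    refine ⟨⟨m, (essAscent_eq_iff T m).2 ⟨hm, hmin⟩, isClosed_range_pow_succ hcm hd⟩,
      ⟨m, (essDescent_eq_iff T m).2 ⟨hd, fun k hk => hmin k ?_⟩, hcm⟩⟩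
    exact nullity_lt_top_of_defect_lt_top _ hk h1

end Banach

/-! ### Algebra of the Kato decomposition. -/

section KatoAlgebra

variable {K : Type*} [Field K] {V : Type*} [AddCommGroup V] [Module K V]

/-- The sum `H + T H + ⋯ + T^(k-1) H`. -/
def orbitSum (T : V →ₗ[K] V) (H : Submodule K V) : ℕ → Submodule K V
  | 0 => ⊥
  | k + 1 => H ⊔ (orbitSum T H k).map T

theorem finiteDimensional_orbitSum (T : V →ₗ[K] V) (H : Submodule K V) [FiniteDimensional K H]
    (k : ℕ) : FiniteDimensional K (orbitSum T H k) := by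
  induction k with
  | zero => exact inferInstanceAs (FiniteDimensional K (⊥ : Submodule K V))
  | succ k ih =>
    exact inferInstanceAs (FiniteDimensional K (H ⊔ (orbitSum T H k).map T : Submodule K V))

theorem map_range_pow_le (T : V →ₗ[K] V) (n : ℕ) : (T ^ n).range.map T ≤ (T ^ (n + 1)).range := by
  rintro _ ⟨_, ⟨y, rfl⟩, rfl⟩
  exact ⟨y, by rw [pow_succ', Module.End.mul_apply]⟩

theorem map_ker_pow_le (T : V →ₗ[K] V) (n : ℕ) : (T ^ n).ker.map T ≤ (T ^ n).ker := by
  rintro _ ⟨y, hy, rfl⟩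
  rw [SetLike.mem_coe, LinearMap.mem_ker] at hy
  rw [LinearMap.mem_ker, ← Module.End.mul_apply, ← pow_succ, pow_succ', Module.End.mul_apply, hy,
    map_zero]

/-- The only new summand, `Tᵏ H`, lies in R(Tᵏ). This makes R(Tᵖ) + `orbitSum T H p` invariant. -/
theorem orbitSum_succ_le (T : V →ₗ[K] V) (H : Submodule K V) (k : ℕ) :
    orbitSum T H (k + 1) ≤ (T ^ k).range ⊔ orbitSum T H k := by
  induction k with
  | zero =>
    rw [pow_zero, Module.End.one_eq_id, LinearMap.range_id, top_sup_eq]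
    exact le_top
  | succ k ih =>
    refine sup_le (le_sup_left.trans le_sup_right) ((Submodule.map_mono ih).trans ?_)
    rw [Submodule.map_sup]
    exact sup_le_sup (map_range_pow_le T k) le_sup_right

theorem map_range_pow_sup_orbitSum_le (T : V →ₗ[K] V) (H : Submodule K V) (p : ℕ) :
    ((T ^ p).range ⊔ orbitSum T H p).map T ≤ (T ^ p).range ⊔ orbitSum T H p := by
  rw [Submodule.map_sup]
  refine sup_le ((map_range_pow_le T p).trans ((range_pow_anti T p.le_succ).trans le_sup_left)) ?_
  exact le_sup_right.trans (orbitSum_succ_le T H p)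

theorem range_pow_sup_ker_pow_sup_orbitSum {T : V →ₗ[K] V} {H : Submodule K V} {p : ℕ}
    (hH : T.range ⊔ (T ^ p).ker ⊔ H = ⊤) (k : ℕ) :
    (T ^ k).range ⊔ (T ^ p).ker ⊔ orbitSum T H k = ⊤ := by
  induction k with
  | zero =>
    rw [pow_zero, Module.End.one_eq_id, LinearMap.range_id, top_sup_eq, top_sup_eq]
  | succ k ih =>
    rw [eq_top_iff, ← hH]
    refine sup_le (sup_le ?_ (le_sup_right.trans le_sup_left)) (le_sup_left.trans le_sup_right)
    rw [LinearMap.range_eq_map, ← ih, Submodule.map_sup, Submodule.map_sup]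
    exact sup_le_sup (sup_le_sup (map_range_pow_le T k) (map_ker_pow_le T p)) le_sup_right

/-- Write x = T^(q+1) z + h + T y. Since `Tᵖ x = 0`, h lies in R(T) + N(Tᵖ), so h = 0 and x = T(T^q
z + y). Then Tᵖ(T^q z + y) lies in N(T) ∩ R(Tᵖ), hence in R(T^(p+q)); subtracting some T^q u makes
the induction hypothesis applicable. Both `k` and `q` fall by one, hence the quantifier over `q`. -/
theorem mem_range_pow_of_mem_sup_orbitSum {T : V →ₗ[K] V} {H : Submodule K V} {p : ℕ}
    (hH : Disjoint (T.range ⊔ (T ^ p).ker) H)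
    (hT : ∀ n, T.ker ⊓ (T ^ p).range ≤ (T ^ n).range) (k : ℕ) :
    ∀ q, k ≤ q → ∀ x ∈ (T ^ q).range ⊔ orbitSum T H k, (T ^ p) x = 0 → x ∈ (T ^ q).range := by
  induction k with
  | zero =>
    intro q _ x hx _
    rwa [orbitSum, sup_bot_eq] at hx
  | succ k ih =>
    rintro (_ | q) hkq x hx hx0
    · omega
    obtain ⟨_, ⟨z, rfl⟩, w, hw, rfl⟩ := Submodule.mem_sup.1 hx
    obtain ⟨h, hh, _, ⟨y, hy, rfl⟩, rfl⟩ := Submodule.mem_sup.1 hw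
    obtain rfl : h = 0 := by
      refine Submodule.disjoint_def.1 hH h ?_ hh
      have h1 : h = T (-((T ^ q) z + y)) + ((T ^ (q + 1)) z + (h + T y)) := by
        rw [pow_succ', Module.End.mul_apply, map_neg, map_add]
        abel
      rw [h1]
      exact add_mem (Submodule.mem_sup_left ⟨_, rfl⟩) (Submodule.mem_sup_right hx0)
    have h2 : (T ^ (q + 1)) z + (0 + T y) = T ((T ^ q) z + y) := by
      rw [zero_add, pow_succ', Module.End.mul_apply, map_add]
    rw [h2] at hx0 ⊢
    have h3 : (T ^ p) ((T ^ q) z + y) ∈ T.ker ⊓ (T ^ p).range := by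
      refine ⟨?_, _, rfl⟩
      rwa [SetLike.mem_coe, ← mem_ker_pow_succ, LinearMap.mem_ker, pow_succ,
        Module.End.mul_apply]
    obtain ⟨u, hu⟩ := hT (p + q) h3
    have h4 := ih q (Nat.le_of_succ_le_succ hkq) ((T ^ q) z + y - (T ^ q) u) ?_ ?_
    · have h5 : (T ^ q) z + y ∈ (T ^ q).range := by
        have := add_mem h4 (⟨u, rfl⟩ : (T ^ q) u ∈ (T ^ q).range)
        rwa [sub_add_cancel] at this
      exact map_range_pow_le T q (Submodule.mem_map_of_mem h5)
    · rw [add_sub_right_comm, ← map_sub]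
      exact Submodule.add_mem_sup ⟨_, rfl⟩ hy
    · rw [map_sub, ← hu, pow_add, Module.End.mul_apply, sub_self]

/-- If `φ` is a projection onto `N(T) ∩ R(Tᵖ)`, the vectors `x` of `N(Tᵖ)` with `φ (Tʲ x) = 0`
for `j < p` form a complement of `N(Tᵖ) ∩ R(Tᵖ)` in `N(Tᵖ)`. -/
def nilpotentPart {W : Type*} [AddCommGroup W] [Module K W] (T : V →ₗ[K] V) (p : ℕ)
    (φ : V →ₗ[K] W) : Submodule K V :=
  (T ^ p).ker ⊓ ⨅ j : ℕ, (φ ∘ₗ T ^ j).ker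

theorem mem_nilpotentPart {W : Type*} [AddCommGroup W] [Module K W] {T : V →ₗ[K] V} {p : ℕ}
    {φ : V →ₗ[K] W} {x : V} :
    x ∈ nilpotentPart T p φ ↔ (T ^ p) x = 0 ∧ ∀ j, φ ((T ^ j) x) = 0 := by
  simp [nilpotentPart]

theorem apply_mem_nilpotentPart {W : Type*} [AddCommGroup W] [Module K W] {T : V →ₗ[K] V} {p : ℕ}
    {φ : V →ₗ[K] W} {x : V} (hx : x ∈ nilpotentPart T p φ) : T x ∈ nilpotentPart T p φ := by
  rw [mem_nilpotentPart] at hx ⊢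
  have h (j) : (T ^ j) (T x) = (T ^ (j + 1)) x := by rw [pow_succ, Module.End.mul_apply]
  refine ⟨?_, fun j => by rw [h, hx.2]⟩
  rw [h, pow_succ', Module.End.mul_apply, hx.1, map_zero]

theorem disjoint_range_pow_nilpotentPart {T : V →ₗ[K] V} {p : ℕ}
    {φ : V →ₗ[K] (T.ker ⊓ (T ^ p).range : Submodule K V)}
    (hφ : ∀ x : (T.ker ⊓ (T ^ p).range : Submodule K V), φ x = x) :
    Disjoint (T ^ p).range (nilpotentPart T p φ) := by
  rw [Submodule.disjoint_def]
  intro x hx hN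
  rw [mem_nilpotentPart] at hN
  -- Descending induction on the exponent: once the next power kills `x`, the current image lies in
  -- N(T) ∩ R(Tᵖ), where `φ` both fixes it and kills it.
  have key : ∀ k ≤ p, (T ^ (p - k)) x = 0 := by
    intro k
    induction k with
    | zero => exact fun _ => hN.1
    | succ k ih =>
      intro hk
      have h1 := ih (by omega)
      have h2 : (T ^ (p - (k + 1))) x ∈ T.ker ⊓ (T ^ p).range := by
        refine ⟨?_, ?_⟩
        · rw [SetLike.mem_coe, ← mem_ker_pow_succ, show p - (k + 1) + 1 = p - k by omega]
          exact h1
        · obtain ⟨y, rfl⟩ := hx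
          exact ⟨(T ^ (p - (k + 1))) y, by
            rw [← Module.End.mul_apply, ← Module.End.mul_apply, ← pow_add, ← pow_add, add_comm]⟩
      have h3 := hφ ⟨_, h2⟩
      rw [hN.2] at h3
      exact (congrArg Subtype.val h3).symm
  simpa using key p le_rfl

theorem ker_pow_le_range_pow_sup_nilpotentPart {T : V →ₗ[K] V} {p : ℕ}
    {φ : V →ₗ[K] (T.ker ⊓ (T ^ p).range : Submodule K V)}
    (hφ : ∀ x : (T.ker ⊓ (T ^ p).range : Submodule K V), φ x = x)
    (hT : ∀ n, T.ker ⊓ (T ^ p).range ≤ (T ^ n).range) :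
    (T ^ p).ker ≤ (T ^ p).range ⊔ nilpotentPart T p φ := by
  intro x hx
  -- The conditions `φ (Tʲ (x - w)) = 0` are achieved for j = p - 1, p - 2, …, 0 in turn. The error
  -- `e` at `j` equals `Tʲ u` with `u` in R(Tᵖ); as `T e = 0`, adding `u` to `w` leaves the
  -- conditions at higher exponents intact.
  have key : ∀ k ≤ p, ∃ w ∈ (T ^ p).range ⊓ (T ^ p).ker,
      ∀ j, p ≤ j + k → φ ((T ^ j) (x - w)) = 0 := by
    intro k
    induction k with
    | zero =>
      refine fun _ => ⟨0, zero_mem _, fun j hj => ?_⟩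
      rw [sub_zero, LinearMap.mem_ker.1 (ker_pow_mono T (by omega) hx : x ∈ (T ^ j).ker), map_zero]
    | succ k ih =>
      intro hk
      obtain ⟨w, hw, hj⟩ := ih (by omega)
      obtain ⟨j, rfl⟩ : ∃ j, p = j + (k + 1) := ⟨p - (k + 1), by omega⟩
      set e := φ ((T ^ j) (x - w)) with he
      obtain ⟨v, hv⟩ := hT (j + (j + (k + 1))) e.2
      set u := (T ^ (j + (k + 1))) v with hu
      have h1 : (T ^ j) u = e := by
        rw [← hv, pow_add _ j (j + (k + 1)), Module.End.mul_apply]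
      have h2 : ∀ i, j < i → (T ^ i) u = 0 := by
        intro i hi
        obtain ⟨l, rfl⟩ := Nat.exists_eq_add_of_le' (Nat.succ_le_of_lt hi)
        rw [Nat.succ_eq_add_one, pow_add, Module.End.mul_apply, pow_succ', Module.End.mul_apply,
          h1, LinearMap.mem_ker.1 e.2.1, map_zero]
      refine ⟨w + u, add_mem hw ⟨⟨v, rfl⟩, h2 _ (by omega)⟩, fun i hi => ?_⟩
      rcases (show j ≤ i by omega).eq_or_lt with rfl | hlt
      · rw [← sub_sub, map_sub, h1, map_sub, ← he, hφ, sub_self]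
      · rw [← sub_sub, map_sub, h2 i hlt, sub_zero]
        exact hj i (by omega)
  obtain ⟨w, hw, hj⟩ := key p le_rfl
  refine Submodule.mem_sup.2 ⟨w, hw.1, x - w, mem_nilpotentPart.2 ⟨?_, fun j => hj j le_add_self⟩,
    add_sub_cancel _ _⟩
  rw [map_sub, LinearMap.mem_ker.1 hx, LinearMap.mem_ker.1 hw.2, sub_zero]

end KatoAlgebra

/-! ### The Kato decomposition of a B-Fredholm operator. -/

section KatoDecomposition

universe u

variable {X : Type u} [NormedAddCommGroup X] [NormedSpace ℂ X]

theorem exists_ker_inf_range_pow_le {K : Type*} [Field K] {V : Type u} [AddCommGroup V]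
    [Module K V] {T : V →ₗ[K] V} {n : ℕ} (hn : nullity T n < ⊤) :
    ∃ p, n ≤ p ∧ 0 < p ∧ ∀ m, T.ker ⊓ (T ^ p).range ≤ (T ^ m).range := by
  -- The nullities attain a minimum; from there on the finite-dimensional spaces N(T) ∩ R(Tᵐ) are
  -- nested of equal dimension, hence constant. Taking `n + 1` makes the exponent positive, so that
  -- N(T) ⊆ N(Tᵖ).
  obtain ⟨_, ⟨p, rfl⟩, hp⟩ := wellFounded_lt.has_min (Set.range (nullity T)) ⟨_, n, rfl⟩
  refine ⟨max p (n + 1), by omega, by omega, fun m => ?_⟩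
  generalize hP : max p (n + 1) = P
  have hpP : p ≤ P := by omega
  have hnP : n ≤ P := by omega
  rcases le_total m P with hm | hm
  · exact inf_le_right.trans (range_pow_anti T hm)
  have h1 : nullity T m = nullity T P :=
    le_antisymm (nullity_anti T hm) ((nullity_anti T hpP).trans (not_lt.1 (hp _ ⟨m, rfl⟩)))
  have h2 : T.ker ⊓ (T ^ m).range ≤ T.ker ⊓ (T ^ P).range :=
    inf_le_inf_left _ (range_pow_anti T hm)
  have h3 : Module.Finite K (T.ker ⊓ (T ^ P).range : Submodule K V) :=
    edim_lt_top.1 ((nullity_anti T hnP).trans_lt hn)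
  have h4 : Module.finrank K (T.ker ⊓ (T ^ m).range : Submodule K V) =
      Module.finrank K (T.ker ⊓ (T ^ P).range : Submodule K V) :=
    congrArg ENat.toNat h1
  rw [← Submodule.eq_of_le_of_finrank_eq h2 h4]
  exact inf_le_right

theorem exists_isRed_of_isBFredholm [CompleteSpace X] {T : X →L[ℂ] X} (hT : IsBFredholm T) :
    ∃ (M N : Submodule ℂ X) (h : IsRed T M N), nullity (h.left : M →ₗ[ℂ] M) 0 < ⊤ ∧
      defect (h.left : M →ₗ[ℂ] M) 0 < ⊤ ∧ IsNilpotent h.right := by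
  obtain ⟨n, hn, hd, hc⟩ := (isBFredholm_iff T).1 hT
  obtain ⟨p, hnp, hp, hp'⟩ := exists_ker_inf_range_pow_le hn
  have hcp := isClosed_range_pow_of_ge hnp hc hd
  have hdp := (defect_anti _ hnp).trans_lt hd
  have hnp := (nullity_anti _ hnp).trans_lt hn
  obtain ⟨H, hH, hHfin⟩ := exists_isCompl_finiteDimensional hdp
  set L : X →ₗ[ℂ] X := (T : X →ₗ[ℂ] X) with hL
  have hpow (j : ℕ) : L ^ j = (T ^ j : X →L[ℂ] X) := (ContinuousLinearMap.toLinearMap_pow T j).symm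
  have hDfin : FiniteDimensional ℂ (L.ker ⊓ (L ^ p).range : Submodule ℂ X) := edim_lt_top.1 hnp
  obtain ⟨φ, hφ⟩ := Submodule.ClosedComplemented.of_finiteDimensional (𝕜 := ℂ)
    (L.ker ⊓ (L ^ p).range : Submodule ℂ X)
  set N := nilpotentPart L p (φ : X →ₗ[ℂ] (L.ker ⊓ (L ^ p).range : Submodule ℂ X)) with hN
  set M := (L ^ p).range ⊔ orbitSum L H p with hM
  have hφ' : ∀ x : (L.ker ⊓ (L ^ p).range : Submodule ℂ X), (φ : X →ₗ[ℂ] _) x = x := hφ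
  have hred : IsRed T M N := by
    constructor
    · have := finiteDimensional_orbitSum L H p
      refine Submodule.isClosed_sup_finiteDimensional _ _ ?_
      rwa [hpow]
    · have : (N : Set X) = (T ^ p) ⁻¹' {0} ∩ ⋂ j : ℕ, (fun x => φ ((T ^ j) x)) ⁻¹' {0} := by
        ext x
        rw [SetLike.mem_coe, hN, mem_nilpotentPart, Set.mem_inter_iff, Set.mem_iInter]
        simp only [hpow]
        rfl
      rw [this]
      refine (isClosed_singleton.preimage (T ^ p).continuous).inter (isClosed_iInter fun j => ?_)
      exact isClosed_singleton.preimage (φ.continuous.comp (T ^ j).continuous)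
    · exact fun x hx => map_range_pow_sup_orbitSum_le L H p (Submodule.mem_map_of_mem hx)
    · exact fun x hx => apply_mem_nilpotentPart hx
    · constructor
      · rw [Submodule.disjoint_def]
        intro x hxM hxN
        exact Submodule.disjoint_def.1 (disjoint_range_pow_nilpotentPart hφ') x
          (mem_range_pow_of_mem_sup_orbitSum hH.disjoint hp' p p le_rfl x hxM
            (mem_nilpotentPart.1 hxN).1) hxN
      · rw [codisjoint_iff, eq_top_iff, ← range_pow_sup_ker_pow_sup_orbitSum hH.sup_eq_top p]
        refine sup_le (sup_le (le_sup_left.trans le_sup_left) ?_) (le_sup_right.trans le_sup_left)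
        exact (ker_pow_le_range_pow_sup_nilpotentPart hφ' hp').trans
          (sup_le_sup_right le_sup_left _)
  -- Vectors of `M` killed by `Tᵖ` lie in R(Tᵖ), so the kernel of the restriction to `M` embeds in
  -- N(T) ∩ R(Tᵖ).
  have h0 : nullity (hred.left : M →ₗ[ℂ] M) 0 < ⊤ := by
    rw [nullity, pow_zero, Module.End.one_eq_id, LinearMap.range_id, inf_top_eq, edim_lt_top]
    refine Module.Finite.of_injective
      (((M.subtype ∘ₗ (hred.left : M →ₗ[ℂ] M).ker.subtype).codRestrict
        (L.ker ⊓ (L ^ p).range) fun x => ?_)) ?_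
    · have h1 : L x.1 = 0 := congrArg Subtype.val (LinearMap.mem_ker.1 x.2)
      refine ⟨h1, mem_range_pow_of_mem_sup_orbitSum hH.disjoint hp' p p le_rfl x.1 x.1.2 ?_⟩
      obtain ⟨q, rfl⟩ := Nat.exists_eq_add_of_lt hp
      rw [zero_add, pow_succ, Module.End.mul_apply, h1, map_zero]
    · intro x y hxy
      exact Subtype.ext (Subtype.ext (congrArg
        (fun z : (L.ker ⊓ (L ^ p).range : Submodule ℂ X) => (z : X)) hxy))
  refine ⟨M, N, hred, h0, ?_, p, ?_⟩
  · rw [hL, hred.defect_eq, ENat.add_lt_top] at hdp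
    exact defect_lt_top_of_nullity_lt_top _ h0 hdp.1
  · ext x
    have h1 := (mem_nilpotentPart.1 x.2).1
    rw [hpow] at h1
    exact (restrict_pow_apply T hred.mapsTo_right p x).trans h1

end KatoDecomposition

/-! ### Stability of the Fredholm index under small scalar perturbations. -/

section IndexStability

universe u

/-- With `q` the projection onto `Z` along `U(E)`, `r` is the rank of `q ∘ U`: its kernel is `E ⊕
ker U`, and its cokernel in `Z` is that of `U`. In finite dimensions the index of `U` is therefore
codim E - dim Z. -/
theorem exists_edim_eq_add {K : Type*} [Field K] {V : Type u} [AddCommGroup V] [Module K V]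
    (U : V →ₗ[K] V) (E Z : Submodule K V)
    (h : Function.Bijective ((U ∘ₗ E.subtype).coprod Z.subtype)) :
    ∃ r, edim K (V ⧸ E) = nullity U 0 + r ∧ edim K Z = defect U 0 + r := by
  set e := LinearEquiv.ofBijective _ h with he
  have he' (x : E) (z : Z) : e (x, z) = U x + z := by simp [he]
  set q : V →ₗ[K] Z := LinearMap.snd K E Z ∘ₗ e.symm.toLinearMap with hq
  have hqU (x : E) (z : Z) : q (U x + z) = z := by
    rw [← he']
    simp [hq]
  have hqE (x : E) : q (U x) = 0 := by simpa using hqU x 0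
  have hker {y : V} (hy : q y = 0) : ∃ x : E, y = U x := by
    obtain ⟨⟨x, z⟩, rfl⟩ := e.surjective y
    rw [he', hqU] at hy
    exact ⟨x, by rw [he', hy]; simp⟩
  have hinj {x : V} (hx : x ∈ E) (hx0 : U x = 0) : x = 0 := by
    have : e (⟨x, hx⟩, 0) = e 0 := by
      rw [he', map_zero, hx0]
      simp
    exact congrArg (fun y => ((y.1 : E) : V)) (e.injective this)
  have hkq : (q ∘ₗ U).ker = E ⊔ U.ker := by
    apply le_antisymm
    · intro x hx
      obtain ⟨y, hy⟩ := hker (LinearMap.mem_ker.1 hx)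
      refine Submodule.mem_sup.2 ⟨y, y.2, x - y, ?_, add_sub_cancel _ _⟩
      rw [LinearMap.mem_ker, map_sub, hy, sub_self]
    · refine sup_le (fun x hx => hqE ⟨x, hx⟩) (fun x hx => ?_)
      rw [LinearMap.mem_ker, LinearMap.comp_apply, LinearMap.mem_ker.1 hx, map_zero]
  refine ⟨edim K (q ∘ₗ U).range, ?_, ?_⟩
  · rw [edim_quotient_of_le (le_sup_left : E ≤ E ⊔ U.ker), Submodule.map_sup,
      Submodule.mkQ_map_self, bot_sup_eq, ← hkq, edim_congr (q ∘ₗ U).quotKerEquivRange]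
    congr 1
    have h1 := edim_map_mkQ_add E U.ker
    have h2 : E ⊓ U.ker = ⊥ := by
      rw [eq_bot_iff]
      exact fun x hx => hinj hx.1 hx.2
    have h3 : edim K (⊥ : Submodule K V) = 0 := by simp [edim]
    rw [h2, h3, add_zero] at h1
    rw [h1, nullity, pow_zero, Module.End.one_eq_id, LinearMap.range_id, inf_top_eq]
  · rw [← edim_quotient_add (q ∘ₗ U).range, defect, pow_zero, Module.End.one_eq_id,
      LinearMap.ker_id, sup_bot_eq]
    congr 1
    refine (edim_quotient_eq_of_surjective ((q ∘ₗ U).range.mkQ ∘ₗ q) ?_ ?_).symm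
    · refine (Submodule.mkQ_surjective _).comp fun z => ⟨z, ?_⟩
      simpa using hqU 0 z
    · rw [LinearMap.ker_comp, Submodule.ker_mkQ]
      apply le_antisymm
      · rintro y ⟨x, hx⟩
        obtain ⟨x', hx'⟩ := hker (y := y - U x) (by
          rw [map_sub, ← hx, LinearMap.comp_apply, sub_self])
        exact ⟨x + x', by rw [map_add, ← hx', add_sub_cancel]⟩
      · rintro _ ⟨x, rfl⟩
        exact ⟨x, rfl⟩

variable {X : Type u} [NormedAddCommGroup X] [NormedSpace ℂ X] [CompleteSpace X]

open Filter Topology in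
-- Let `E` be a closed complement of the kernel and `Z` a complement of the range. The map `E × Z →
-- X` stays invertible for small `w`, so the same `E` and `Z` compute the index of every `S - w`.
theorem eventually_hasIndex_sub_smul_one {S : X →L[ℂ] X} (hn : nullity (S : X →ₗ[ℂ] X) 0 < ⊤)
    (hd : defect (S : X →ₗ[ℂ] X) 0 < ⊤) {i : ℤ} (hi : HasIndex (S : X →ₗ[ℂ] X) i) :
    ∀ᶠ w in 𝓝 (0 : ℂ), HasIndex ((S - w • (1 : X →L[ℂ] X) : X →L[ℂ] X) : X →ₗ[ℂ] X) i := by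
  have hn' : FiniteDimensional ℂ S.ker := by
    rwa [nullity, pow_zero, Module.End.one_eq_id, LinearMap.range_id, inf_top_eq, edim_lt_top]
      at hn
  have hd' : edim ℂ (X ⧸ S.range) < ⊤ := by
    rwa [defect, pow_zero, Module.End.one_eq_id, LinearMap.ker_id, sup_bot_eq] at hd
  obtain ⟨Z, hZ, hZfin⟩ := exists_isCompl_finiteDimensional hd'
  obtain ⟨E, hE, hEc⟩ := (Submodule.ClosedComplemented.of_finiteDimensional (𝕜 := ℂ)
    S.ker).exists_isClosed_isCompl
  have := hE.completeSpace_coe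
  set J : (E × Z) →L[ℂ] X := (S ∘L E.subtypeL).coprod Z.subtypeL with hJ
  set P : (E × Z) →L[ℂ] X := E.subtypeL ∘L ContinuousLinearMap.fst ℂ E Z with hP
  have hJker : J.ker = ⊥ := by
    rw [eq_bot_iff]
    rintro ⟨x, z⟩ hxz
    have h1 : S x + z = 0 := by simpa [hJ] using hxz
    have h2 : (z : X) = 0 := by
      refine Submodule.disjoint_def.1 hZ.disjoint _ ⟨-x, ?_⟩ z.2
      rw [map_neg]
      exact neg_eq_of_add_eq_zero_right h1
    have h3 : (x : X) = 0 := by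
      refine Submodule.disjoint_def.1 hEc.disjoint _ ?_ x.2
      rw [LinearMap.mem_ker]
      simpa [h2] using h1
    simp [Subtype.ext_iff, h2, h3]
  have hJrange : J.range = ⊤ := by
    rw [eq_top_iff]
    intro y _
    obtain ⟨_, ⟨x, rfl⟩, z, hz, rfl⟩ :=
      Submodule.mem_sup.1 (hZ.sup_eq_top ▸ Submodule.mem_top (x := y))
    obtain ⟨k, hk, x, hx, rfl⟩ :=
      Submodule.mem_sup.1 (hEc.sup_eq_top ▸ Submodule.mem_top (x := x))
    refine ⟨(⟨x, hx⟩, ⟨z, hz⟩), ?_⟩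
    have : S k = 0 := hk
    simp [hJ, this]
  have hcont : Continuous fun w : ℂ => J - w • P := by fun_prop
  have hmem := hcont.continuousAt.preimage_mem_nhds (x := 0) (by
    have := (ContinuousLinearEquiv.ofBijective J hJker hJrange).nhds
    rwa [ContinuousLinearEquiv.coe_ofBijective, ← sub_zero J, ← zero_smul ℂ P] at this)
  have key : ∀ w : ℂ, Function.Bijective (J - w • P) → ∃ r,
      edim ℂ (X ⧸ E) = nullity ((S - w • (1 : X →L[ℂ] X) : X →L[ℂ] X) : X →ₗ[ℂ] X) 0 + r ∧
      edim ℂ Z = defect ((S - w • (1 : X →L[ℂ] X) : X →L[ℂ] X) : X →ₗ[ℂ] X) 0 + r := by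
    intro w hw
    apply exists_edim_eq_add
    convert hw using 1
    ext ⟨x, z⟩
    simp [hJ, hP]
    abel
  obtain ⟨r, hr1, hr2⟩ := key 0 (by
    rw [zero_smul, sub_zero]
    exact ⟨LinearMap.ker_eq_bot.1 hJker, LinearMap.range_eq_top.1 hJrange⟩)
  rw [zero_smul, sub_zero] at hr1 hr2
  have hE' : edim ℂ (X ⧸ E) < ⊤ := by
    rwa [edim_congr (E.quotientEquivOfIsCompl _ hEc.symm), edim_lt_top]
  have hZ' : edim ℂ Z < ⊤ := edim_lt_top.2 hZfin
  obtain ⟨a, ha⟩ := ENat.ne_top_iff_exists.1 hE'.ne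
  obtain ⟨b, hb⟩ := ENat.ne_top_iff_exists.1 hZ'.ne
  rw [← ha] at hr1 key
  rw [← hb] at hr2 key
  have hfin : ∀ {x y : ℕ∞} {c : ℕ}, (c : ℕ∞) = x + y → ∃ m n : ℕ, x = m ∧ y = n ∧ c = m + n := by
    intro x y c hc
    have h1 := ENat.add_lt_top.1 (hc ▸ ENat.natCast_lt_top c)
    lift x to ℕ using h1.1.ne
    lift y to ℕ using h1.2.ne
    exact ⟨x, y, rfl, rfl, by exact_mod_cast hc⟩
  have hai : i = a - b := by
    obtain ⟨m, k, hm, hk, h1⟩ := hfin hr1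
    obtain ⟨m', k', hm', hk', h2⟩ := hfin hr2
    have := hi.eq_sub hm hm'
    rw [hk] at hk'
    norm_cast at hk'
    omega
  filter_upwards [hmem] with w hw
  obtain ⟨e, he⟩ := hw
  obtain ⟨r', h1, h2⟩ := key w (by
    have he' : (e : (E × Z) →L[ℂ] X) = J - w • P := he
    rw [← he']
    exact e.bijective)
  obtain ⟨m, k, hm, hk, h1⟩ := hfin h1
  obtain ⟨m', k', hm', hk', h2⟩ := hfin h2
  refine ⟨0, m, m', hm, hm', ?_⟩
  rw [hk] at hk'
  norm_cast at hk'
  omega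

end IndexStability

/-! ### The equivalence and the index formula. -/

section MainTheorem

open Filter Topology

universe u

variable {X : Type u} [NormedAddCommGroup X] [NormedSpace ℂ X]

theorem IsRed.left_sub_smul_one {T : X →L[ℂ] X} {M N : Submodule ℂ X} (h : IsRed T M N) (w : ℂ) :
    ∃ h' : IsRed (T - w • (1 : X →L[ℂ] X)) M N,
      h'.left = h.left - w • (1 : M →L[ℂ] M) ∧ h'.right = h.right - w • (1 : N →L[ℂ] N) := by
  refine ⟨⟨h.isClosed_left, h.isClosed_right, fun x hx => ?_, fun x hx => ?_, h.isCompl⟩, ?_, ?_⟩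
  · exact sub_mem (h.mapsTo_left x hx) (M.smul_mem w hx)
  · exact sub_mem (h.mapsTo_right x hx) (N.smul_mem w hx)
  · rfl
  · rfl

theorem eventually_hasIndex_of_isBFredholm [CompleteSpace X] {T : X →L[ℂ] X} (hT : IsBFredholm T)
    {i : ℤ} (hi : HasIndex (T : X →ₗ[ℂ] X) i) :
    ∀ᶠ w in 𝓝[≠] (0 : ℂ), HasIndex ((T - w • (1 : X →L[ℂ] X) : X →L[ℂ] X) : X →ₗ[ℂ] X) i := by
  obtain ⟨M, N, h, hn, hd, hnil⟩ := exists_isRed_of_isBFredholm hT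
  have := h.isClosed_left.completeSpace_coe
  obtain ⟨j, hj⟩ := exists_hasIndex hn hd
  have hij : i = j := by
    have := h.hasIndex hj (hasIndex_zero_of_isNilpotent (isNilpotent_toLinearMap hnil))
    rw [hi.unique this, add_zero]
  subst hij
  filter_upwards [(eventually_hasIndex_sub_smul_one hn hd hj).filter_mono nhdsWithin_le_nhds,
    self_mem_nhdsWithin] with w hw hw0
  obtain ⟨h', hl, hr⟩ := h.left_sub_smul_one w
  rw [← add_zero i]
  refine h'.hasIndex ?_ ?_
  · rwa [hl]
  · rw [hr]
    exact hasIndex_zero_of_isUnit (isUnit_sub_smul_one_of_isNilpotent hnil hw0)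

theorem IsMeromorphic.hasIndex_zero [CompleteSpace X] {T : X →L[ℂ] X} (hm : IsMeromorphic T)
    (hT : IsBFredholm T) : HasIndex (T : X →ₗ[ℂ] X) 0 := by
  obtain ⟨n, hn, hd, -⟩ := (isBFredholm_iff T).1 hT
  obtain ⟨i, hi⟩ := exists_hasIndex hn hd
  -- Punctured neighbourhoods of 0 in ℂ are nonempty, so some `w ≠ 0` has both properties.
  obtain ⟨w, hw, hw0⟩ := ((eventually_hasIndex_of_isBFredholm hT hi).and
    self_mem_nhdsWithin).exists
  rwa [hw.unique (hm w hw0).hasIndex_zero] at hi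

theorem IsRed.coe_right_pow_range {T : X →L[ℂ] X} {M N : Submodule ℂ X} (h : IsRed T M N)
    (n : ℕ) : ((h.right ^ n).range : Set N) = Subtype.val ⁻¹' ((T ^ n).range : Set X) := by
  ext x
  simp only [SetLike.mem_coe, Set.mem_preimage, LinearMap.mem_range, ContinuousLinearMap.coe_coe]
  constructor
  · rintro ⟨y, rfl⟩
    exact ⟨y, (restrict_pow_apply T h.mapsTo_right n y).symm⟩
  · rintro ⟨y, hy⟩
    obtain ⟨a, ha, b, hb, rfl⟩ :=
      Submodule.mem_sup.1 (h.isCompl.sup_eq_top ▸ Submodule.mem_top (x := y))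
    have h1 := restrict_pow_apply T h.mapsTo_left n ⟨a, ha⟩
    have h2 := restrict_pow_apply T h.mapsTo_right n ⟨b, hb⟩
    refine ⟨⟨b, hb⟩, Subtype.ext (h2.trans ?_)⟩
    have h3 : (T ^ n) a = 0 := by
      refine Submodule.disjoint_def.1 h.isCompl.disjoint _ (h1 ▸ Subtype.property _) ?_
      rw [map_add] at hy
      rw [eq_sub_of_add_eq hy]
      exact sub_mem x.2 (h2 ▸ Subtype.property _)
    rw [← hy, map_add, h3, zero_add]

theorem IsRed.isBFredholm_right [CompleteSpace X] {T : X →L[ℂ] X} {M N : Submodule ℂ X}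
    (h : IsRed T M N) (hT : IsBFredholm T) : IsBFredholm h.right := by
  have := h.isClosed_right.completeSpace_coe
  obtain ⟨n, hn, hd, hc⟩ := (isBFredholm_iff T).1 hT
  rw [h.nullity_eq, ENat.add_lt_top] at hn
  rw [h.defect_eq, ENat.add_lt_top] at hd
  refine (isBFredholm_iff _).2 ⟨n, hn.2, hd.2, ?_⟩
  rw [h.coe_right_pow_range]
  exact hc.preimage continuous_subtype_val

theorem exists_isRed_semiFredholm_of_isBFredholm [CompleteSpace X] {T : X →L[ℂ] X}
    (hT : IsBFredholm T) : ∃ (M N : Submodule ℂ X) (h : IsRed T M N),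
      IsUpperSemiFredholm h.left ∧ IsLowerSemiFredholm h.left ∧ IsNilpotent h.right := by
  obtain ⟨M, N, h, hn, hd, hnil⟩ := exists_isRed_of_isBFredholm hT
  have := h.isClosed_left.completeSpace_coe
  refine ⟨M, N, h, (isUpperSemiFredholm_iff _).2 ⟨hn, ?_⟩, (isLowerSemiFredholm_iff _).2 hd, hnil⟩
  refine isClosed_range_of_edim_quotient_lt_top _ ?_
  rwa [defect, pow_zero, Module.End.one_eq_id, LinearMap.ker_id, sup_bot_eq] at hd

theorem nullity_defect_eq_zero_of_pow_eq_zero {K V : Type*} [Field K] [AddCommGroup V] [Module K V]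
    {T : V →ₗ[K] V} {n m : ℕ} (h : T ^ n = 0) (hm : n ≤ m) :
    nullity T m = 0 ∧ defect T m = 0 := by
  rw [nullity, defect, pow_eq_zero_of_le hm h, LinearMap.range_zero, LinearMap.ker_zero,
    inf_bot_eq, sup_top_eq]
  simp [edim]

theorem isBFredholm_of_isQuasiBFredholm [CompleteSpace X] {T : X →L[ℂ] X}
    (hT : IsQuasiBFredholm T) : IsBFredholm T := by
  obtain ⟨⟨M, N, h, hu, p, hp⟩, ⟨M', N', h', hl, p', hp'⟩⟩ := hT
  have := h.isClosed_left.completeSpace_coe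
  have hz : (h.right : N →ₗ[ℂ] N) ^ p = 0 := by
    rw [← ContinuousLinearMap.toLinearMap_pow, hp]
    rfl
  have hz' : (h'.right : N' →ₗ[ℂ] N') ^ p' = 0 := by
    rw [← ContinuousLinearMap.toLinearMap_pow, hp']
    rfl
  refine (isBFredholm_iff T).2 ⟨max p p', ?_, ?_, ?_⟩
  · rw [h.nullity_eq, (nullity_defect_eq_zero_of_pow_eq_zero hz (le_max_left _ _)).1, add_zero]
    exact (nullity_anti _ (Nat.zero_le _)).trans_lt ((isUpperSemiFredholm_iff _).1 hu).1
  · rw [h'.defect_eq, (nullity_defect_eq_zero_of_pow_eq_zero hz' (le_max_right _ _)).2, add_zero]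
    exact (defect_anti _ (Nat.zero_le _)).trans_lt ((isLowerSemiFredholm_iff _).1 hl)
  -- The nilpotent part vanishes at this power, so R(Tⁿ) is the range of the power of the
  -- restriction to `M`.
  · have h1 := isClosed_range_pow_of_isUpperSemiFredholm hu (max p p')
    have h2 := (h.isClosed_left.isClosedEmbedding_subtypeVal).isClosedMap _ h1
    convert h2 using 1
    ext y
    constructor
    · rintro ⟨x, rfl⟩
      obtain ⟨a, ha, b, hb, rfl⟩ :=
        Submodule.mem_sup.1 (h.isCompl.sup_eq_top ▸ Submodule.mem_top (x := x))
      have h3 : (T ^ max p p') b = 0 := by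
        rw [← restrict_pow_apply T h.mapsTo_right _ ⟨b, hb⟩]
        have : h.right ^ max p p' = 0 := pow_eq_zero_of_le (le_max_left _ _) hp
        exact congrArg Subtype.val (DFunLike.congr_fun this ⟨b, hb⟩)
      refine ⟨_, ⟨⟨a, ha⟩, rfl⟩, ?_⟩
      refine (restrict_pow_apply T h.mapsTo_left _ ⟨a, ha⟩).trans ?_
      simp only [ContinuousLinearMap.coe_coe]
      rw [map_add, h3, add_zero]
    · rintro ⟨_, ⟨x, rfl⟩, rfl⟩
      exact ⟨x, (restrict_pow_apply T h.mapsTo_left _ x).symm⟩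

theorem semiFredholmIndex_eq {T : X →L[ℂ] X} {a b : ℕ} (ha : alpha T = a) (hb : beta T = b) :
    semiFredholmIndex T = (((a - b : ℤ) : ℝ) : EReal) := by
  rw [semiFredholmIndex, ha, hb]
  push_cast
  rfl

theorem HasIndex.bFredholmIndex_eq [CompleteSpace X] {T : X →L[ℂ] X} (hT : IsBFredholm T) {i : ℤ}
    (hi : HasIndex (T : X →ₗ[ℂ] X) i) : bFredholmIndex T = ((i : ℝ) : EReal) := by
  obtain ⟨n, hn, hd, -⟩ := (isBFredholm_iff T).1 hT
  obtain ⟨⟨m, hm, -⟩, -⟩ := hT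
  rw [essAscent_eq_iff] at hm
  have hdm := defect_lt_top_of_nullity_lt_top _ hm.1 hd
  have hdeg : essDegree T = m := (essDegree_eq_iff T m).2 ⟨Or.inl hm.1, fun k hk => hm.2 k
    (hk.elim id fun h => nullity_lt_top_of_defect_lt_top _ h hn)⟩
  obtain ⟨a, ha⟩ := ENat.ne_top_iff_exists.1 hm.1.ne
  obtain ⟨b, hb⟩ := ENat.ne_top_iff_exists.1 hdm.ne
  rw [bFredholmIndex, hdeg, ENat.toNat_natCast,
    semiFredholmIndex_eq ((alpha_iter T m).trans ha.symm) ((beta_iter T m).trans hb.symm),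
    hi.eq_sub ha.symm hb.symm]

theorem semiFredholmIndex_left_eq_bFredholmIndex [CompleteSpace X] {T : X →L[ℂ] X}
    (hT : IsBFredholm T) {M N : Submodule ℂ X} (h : IsRed T M N) (hM : IsSemiFredholm h.left)
    (hN : IsMeromorphic h.right) : semiFredholmIndex h.left = bFredholmIndex T := by
  have := h.isClosed_right.completeSpace_coe
  obtain ⟨n, hn, hd, hc⟩ := (isBFredholm_iff T).1 hT
  rw [h.nullity_eq, ENat.add_lt_top] at hn
  rw [h.defect_eq, ENat.add_lt_top] at hd
  -- As a summand of a B-Fredholm operator, the semi-Fredholm part has finite nullity and defect at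
  -- `n`, which forces both to be finite at 0.
  have h0 : nullity (h.left : M →ₗ[ℂ] M) 0 < ⊤ ∧ defect (h.left : M →ₗ[ℂ] M) 0 < ⊤ := by
    rcases hM with hM | hM
    · have h1 := ((isUpperSemiFredholm_iff _).1 hM).1
      exact ⟨h1, defect_lt_top_of_nullity_lt_top _ h1 hd.1⟩
    · have h1 := (isLowerSemiFredholm_iff _).1 hM
      exact ⟨nullity_lt_top_of_defect_lt_top _ h1 hn.1, h1⟩
  obtain ⟨i, hi⟩ := exists_hasIndex h0.1 h0.2
  obtain ⟨a, ha⟩ := ENat.ne_top_iff_exists.1 h0.1.ne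
  obtain ⟨b, hb⟩ := ENat.ne_top_iff_exists.1 h0.2.ne
  have h1 := h.hasIndex hi (hN.hasIndex_zero (h.isBFredholm_right hT))
  rw [h1.bFredholmIndex_eq hT, add_zero, semiFredholmIndex_eq
    ((alpha_eq_nullity _).trans ha.symm) ((beta_eq_defect _).trans hb.symm),
    hi.eq_sub ha.symm hb.symm]

end MainTheorem

end

end BFredholm

/-- A bounded operator on a complex Banach space is quasi B-Fredholm if and only if it is
B-Fredholm; in that case its index as a quasi B-Fredholm operator exists, does not depend on the
decomposition, and equals its index as a B-Fredholm operator. -/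
theorem mainTheorem5 {X : Type*} [NormedAddCommGroup X] [NormedSpace ℂ X] [CompleteSpace X]
    (T : X →L[ℂ] X) :
    (BFredholm.IsQuasiBFredholm T ↔ BFredholm.IsBFredholm T) ∧
      (BFredholm.IsQuasiBFredholm T →
        ∀ k : EReal, BFredholm.IsDecompositionIndex T k ↔ k = BFredholm.bFredholmIndex T) := by
  refine ⟨⟨BFredholm.isBFredholm_of_isQuasiBFredholm, fun hT => ?_⟩, fun hT k => ?_⟩
  · obtain ⟨M, N, h, hu, hl, hnil⟩ := BFredholm.exists_isRed_semiFredholm_of_isBFredholm hT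
    exact ⟨⟨M, N, h, hu, hnil⟩, ⟨M, N, h, hl, hnil⟩⟩
  · have hB := BFredholm.isBFredholm_of_isQuasiBFredholm hT
    constructor
    · rintro ⟨M, N, h, hM, hN, rfl⟩
      exact BFredholm.semiFredholmIndex_left_eq_bFredholmIndex hB h hM hN
    · rintro rfl
      obtain ⟨M, N, h, hu, -, hnil⟩ := BFredholm.exists_isRed_semiFredholm_of_isBFredholm hB
      have hN := BFredholm.isMeromorphic_of_isNilpotent hnil
      exact ⟨M, N, h, Or.inl hu, hN,
        BFredholm.semiFredholmIndex_left_eq_bFredholmIndex hB h (Or.inl hu) hN⟩
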